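/- Let $N=\{1,\dots,n\}$ ($n\ge 2$) be a set of voters, partitioned into groups $N_1,\dots,N_g$ (put $G=\{1,\dots,g\}$), and let $P=\{p_1,\dots,p_m\}$ be a non-empty set of projects ordered by $p_1\triangleleft\dots\triangleleft p_m$. Let $\mathcal D$ be the set of all single-peaked strict linear orders on $P$: those $\succ$ with top-ranked project $\succ(1)$ such that $p\succ p'$ whenever $\succ(1)\triangleleft p\triangleleft p'$ or $p'\triangleleft p\triangleleft \succ(1)$. For a profile $\mathcal P=(\succ_i)_{i\in N}\in\mathcal D^n$ let $\mathcal P_{N_q}=(\succ_i)_{i\in N_q}$. A random rule is a map $\varphi:\mathcal D^n\to\Delta P$ into the probability distributions on $P$; $\varphi_A(\mathcal P)$ is the probability of $A\subseteq P$ at $\mathcal P$. A deterministic rule is a map $\mathcal D^n\to P$. Fix $\kappa_q\in\{1,\dots,m\}$ and $\eta_q\in[0,1]$ for each $q\in G$, and maps $\psi_q:\mathcal D^{N_q}\to 2^P$ that are compliant with $\kappa$: for every $\mathcal Q\in\mathcal D^{N_q}$ the set $\psi_q(\mathcal Q)$ consists of $\kappa_q$ consecutive projects, and $\succ_i(1)\trianglelefteq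 p\trianglelefteq\,\succ_j(1)$ for some $p\in\psi_q(\mathcal Q)$ and some $i,j\in N_q$. The rule $\varphi$ is *unanimous* if $\varphi_p(\mathcal P)=1$ whenever all voters rank $p$ at the top; *strategy-proof* if for every voter $i$ and every $\succ_i'\in\mathcal D$ the distribution $\varphi(\succ_i,\succ_{-i})$ gives every upper contour set of $\succ_i$ at least the probability that $\varphi(\succ_i',\succ_{-i})$ gives it; *group-wise anonymous* if $\varphi(\mathcal P)=\varphi((\succ_{\pi(i)})_{i\in N})$ for every permutation $\pi$ of $N$ that maps each group to itself; and it satisfies *$(\kappa_G,\psi_G,\eta_G)$-weak-GEG* if $\varphi_{\psi_q(\mathcal P_{N_q})}(\mathcal P)\ge\eta_q$ for all $\mathcal P\in\mathcal D^n$ and $q\in G$. Let $\Gamma=\prod_{q\in G}\{0,\dots,|N_q|\}$, with $\underline\gamma=(0,\dots,0)$ and $\overline\gamma=(|N_1|,\dots,|N_g|)$, and write $\gamma\gg\gamma'$ if $\gamma_q\ge\gamma'_q$ for all $q$. Let $\tau_t(\mathcal P_{N_q})$ be the $t$-th project when the tops of the voters in $N_q$ are sorted increasingly with repetition, and $\tau_0=p_1$.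 A deterministic rule $f$ is a *group min-max rule* with parameters $(\beta^f_\gamma)_{\gamma\in\Gamma}$ in $P$ if $\beta^f_{\underline\gamma}=p_m$, $\beta^f_{\overline\gamma}=p_1$, $\beta^f_\gamma\trianglelefteq\beta^f_{\gamma'}$ whenever $\gamma\gg\gamma'$, and $$f(\mathcal P)=\min_{\gamma\in\Gamma}\max\{\tau_{\gamma_1}(\mathcal P_{N_1}),\dots,\tau_{\gamma_g}(\mathcal P_{N_g}),\beta^f_\gamma\}\quad\text{for all }\mathcal P\in\mathcal D^n.$$ A *random group min-max rule* is a convex combination $\varphi=\sum_{w\in W}\lambda_w\varphi_w$ ($W$ finite, $0\le\lambda_w\le1$, $\sum_w\lambda_w=1$) of deterministic rules such that $\varphi_w$ is a group min-max rule whenever $\lambda_w>0$. A project $p_x$ is *feasible at $(z_1,z_2;\psi_q)$* if for some $\mathcal Q\in\mathcal D^{N_q}$ we have $p_x=\min\psi_q(\mathcal Q)$, exactly $z_1$ voters of $N_q$ have their top before $\min\psi_q(\mathcal Q)$, and exactly $|N_q|-z_2$ voters of $N_q$ have their top after $\max\psi_q(\mathcal Q)$. **Theorem.** A random rule $\varphi$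 is unanimous, strategy-proof, group-wise anonymous and satisfies $(\kappa_G,\psi_G,\eta_G)$-weak-GEG if and only if it is a random group min-max rule $\varphi=\sum_{w\in W}\lambda_w\varphi_w$ such that for all $q\in G$, all $\gamma,\gamma'\in\Gamma$ with $\gamma\gg\gamma'$, and all $p_x\in P$ feasible at $(\gamma'_q,\gamma_q;\psi_q)$, $$\sum_{\{w\,:\,p_x\trianglelefteq\beta^{\varphi_w}_{\gamma'},\ \beta^{\varphi_w}_{\gamma}\trianglelefteq p_{x+\kappa_q-1}\}}\lambda_w\ \ge\ \eta_q .$$ Moreover, if $\varphi$ has these four properties, then this condition holds for every representation of $\varphi$ as a random group min-max rule. -/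

import Mathlib

namespace GroupFair

/-- A single-peaked strictly ordinal preference on the projects `p_1 ◁ ... ◁ p_m`, modelled by
`Fin m` with its usual order (the project `p_j` is the element with value `j - 1`).
`rel p p'` means that `p` is at least as good as `p'`: a complete, reflexive, antisymmetric and
transitive relation. -/
structure SPPref (m : ℕ) where
  rel : Fin m → Fin m → Prop
  refl : ∀ p, rel p p
  total : ∀ p p', rel p p' ∨ rel p' p
  antisymm : ∀ p p', rel p p' → rel p' p → p = p'
  trans : ∀ p p' p'', rel p p' → rel p' p'' → rel p p''
  /-- If `t` is the best project and `p` lies strictly between `t` and `p'`, then `p` is strictly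
  preferred to `p'`. -/
  singlePeaked : ∀ t, (∀ p, rel t p) → ∀ p p',
    ((t < p ∧ p < p') ∨ (p' < p ∧ p < t)) → rel p p' ∧ p ≠ p'

namespace SPPref

theorem exists_top {m : ℕ} [NeZero m] (r : SPPref m) : ∃ t, ∀ p, r.rel t p := by
  have key : ∀ s : Finset (Fin m), s.Nonempty → ∃ t ∈ s, ∀ p ∈ s, r.rel t p := by
    intro s hs
    induction hs using Finset.Nonempty.cons_induction with
    | singleton a => exact ⟨a, by simp, by simpa using r.refl a⟩
    | cons a s ha hs ih =>
      obtain ⟨t, ht, h⟩ := ih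
      rcases r.total a t with hat | hta
      · refine ⟨a, by simp, fun p hp => ?_⟩
        rcases Finset.mem_cons.1 hp with rfl | hp
        · exact r.refl _
        · exact r.trans _ _ _ hat (h p hp)
      · refine ⟨t, by simp [ht], fun p hp => ?_⟩
        rcases Finset.mem_cons.1 hp with rfl | hp
        · exact hta
        · exact h p hp
  obtain ⟨t, -, h⟩ := key Finset.univ ⟨0, Finset.mem_univ _⟩
  exact ⟨t, fun p => h p (Finset.mem_univ p)⟩

/-- The top-ranked project. -/
noncomputable def top {m : ℕ} [NeZero m] (r : SPPref m) : Fin m := r.exists_top.choose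

theorem rel_top {m : ℕ} [NeZero m] (r : SPPref m) (p : Fin m) : r.rel r.top p :=
  r.exists_top.choose_spec p

open Classical in
/-- The upper contour set of `p`: all projects that are at least as good as `p`. -/
noncomputable def upper {m : ℕ} (r : SPPref m) (p : Fin m) : Finset (Fin m) :=
  Finset.univ.filter fun p' => r.rel p' p

end SPPref

/-- A deterministic social choice rule for `n` voters and `m` projects. -/
abbrev DSCR (n m : ℕ) := (Fin n → SPPref m) → Fin m

/-- A random social choice rule; its values are probability distributions over the projects. -/
abbrev RSCR (n m : ℕ) := (Fin n → SPPref m) → stdSimplex ℝ (Fin m)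

/-- The probability that a distribution gives to a project. -/
def prob {m : ℕ} (d : stdSimplex ℝ (Fin m)) (p : Fin m) : ℝ := d.1 p

/-- The probability that a distribution gives to a set of projects. -/
def probSet {m : ℕ} (d : stdSimplex ℝ (Fin m)) (A : Finset (Fin m)) : ℝ := ∑ p ∈ A, prob d p

/-- `d` stochastically dominates `d'` with respect to the preference `r`. -/
def StochDom {m : ℕ} (r : SPPref m) (d d' : stdSimplex ℝ (Fin m)) : Prop :=
  ∀ p, probSet d' (r.upper p) ≤ probSet d (r.upper p)

def Unanimous {n m : ℕ} [NeZero m] (φ : RSCR n m) : Prop :=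
  ∀ (p : Fin m) (P : Fin n → SPPref m), (∀ i, (P i).top = p) → prob (φ P) p = 1

def StrategyProof {n m : ℕ} (φ : RSCR n m) : Prop :=
  ∀ (i : Fin n) (P : Fin n → SPPref m) (r' : SPPref m),
    StochDom (P i) (φ P) (φ (Function.update P i r'))

/-- The voters are partitioned into groups by `grp`, which sends a voter to the index of its group;
this is the group with index `q`. -/
abbrev Members {n g : ℕ} (grp : Fin n → Fin g) (q : Fin g) := {i : Fin n // grp i = q}

/-- The preference profile of the members of a group. -/
def restrict {n m g : ℕ} (grp : Fin n → Fin g) (P : Fin n → SPPref m) (q : Fin g) :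
    Members grp q → SPPref m :=
  fun i => P i.1

def GroupwiseAnonymous {n m g : ℕ} (grp : Fin n → Fin g) (φ : RSCR n m) : Prop :=
  ∀ π : Equiv.Perm (Fin n), (∀ i, grp (π i) = grp i) →
    ∀ P : Fin n → SPPref m, φ P = φ fun i => P (π i)

/-- A representation scenario: for every group, a function that sends the profile of the group to
a set of projects. -/
abbrev RepScenario {n g : ℕ} (m : ℕ) (grp : Fin n → Fin g) :=
  (q : Fin g) → (Members grp q → SPPref m) → Finset (Fin m)

/-- Some representative lies between the top-ranked projects of two voters of the group. -/
def TopRanged {ι : Type*} {m : ℕ} [NeZero m] (ψ : (ι → SPPref m) → Finset (Fin m)) : Prop :=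
  ∀ Q : ι → SPPref m, ∃ p ∈ ψ Q, ∃ i j : ι, (Q i).top ≤ p ∧ p ≤ (Q j).top

/-- Every representative function is top-ranged and selects intervals of `κ q` projects. -/
def Compliant {n m g : ℕ} [NeZero m] {grp : Fin n → Fin g} (κ : Fin g → ℕ)
    (ψ : RepScenario m grp) : Prop :=
  ∀ q, TopRanged (ψ q) ∧
    ∀ Q : Members grp q → SPPref m, (∃ a b, ψ q Q = Finset.Icc a b) ∧ (ψ q Q).card = κ q

/-- The weak group entitlement guarantee. -/
def WeakGEG {n m g : ℕ} {grp : Fin n → Fin g} (ψ : RepScenario m grp) (η : Fin g → ℝ)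
    (φ : RSCR n m) : Prop :=
  ∀ (P : Fin n → SPPref m) (q : Fin g), η q ≤ probSet (φ P) (ψ q (restrict grp P q))

/-- The vectors `γ` with `0 ≤ γ_q ≤ |N_q|` for every group. Here `γ' ≤ γ` (componentwise) is the
dominance of `γ` over `γ'`, `⊥` is the zero vector, and `⊤` is the vector of the group sizes. -/
abbrev Gam {n g : ℕ} (grp : Fin n → Fin g) :=
  (q : Fin g) → Fin (Fintype.card (Members grp q) + 1)

/-- The project at position `t` when the top-ranked projects of a group are sorted increasingly with
repetition, that is, the first project `p` such that at least `t` tops are not after `p`;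
for `t = 0` it is the first project. -/
noncomputable def tau {ι : Type*} [Fintype ι] {m : ℕ} [NeZero m] (t : ℕ) (Q : ι → SPPref m) :
    Fin m :=
  (Finset.univ.filter fun p => t ≤ (Finset.univ.filter fun i => (Q i).top ≤ p).card).inf id

/-- `f` is the group min-max rule with the parameters `β`. -/
def IsGroupMinMaxWith {n m g : ℕ} [NeZero m] (grp : Fin n → Fin g) (f : DSCR n m)
    (β : Gam grp → Fin m) : Prop :=
  β ⊥ = ⊤ ∧ β ⊤ = ⊥ ∧ (∀ γ γ' : Gam grp, γ' ≤ γ → β γ ≤ β γ') ∧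
    ∀ P : Fin n → SPPref m, f P =
      Finset.univ.inf fun γ : Gam grp =>
        max (Finset.univ.sup fun q => tau (γ q : ℕ) (restrict grp P q)) (β γ)

/-- A presentation of `φ` as a random group min-max rule: `φ` is the convex combination of the
rules `rule w` with the weights `weight w`, and every rule of positive weight is a group min-max
rule, whose parameters are `param w`. -/
structure RandomGroupMinMax {n m g : ℕ} [NeZero m] (grp : Fin n → Fin g) (φ : RSCR n m) where
  size : ℕ
  weight : Fin size → ℝ
  rule : Fin size → DSCR n m
  param : Fin size → Gam grp → Fin m
  weight_mem : ∀ w, 0 ≤ weight w ∧ weight w ≤ 1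
  weight_sum : ∑ w, weight w = 1
  isGroupMinMax : ∀ w, 0 < weight w → IsGroupMinMaxWith grp (rule w) (param w)
  eq_mixture : ∀ (P : Fin n → SPPref m) (p : Fin m),
    prob (φ P) p = ∑ w, weight w * (if rule w P = p then 1 else 0)

/-- The project `x` is feasible at `(z₁, z₂; ψ)`: for some profile of the group, `x` is the first
selected project, exactly `z₁` tops lie before it, and exactly `|group| - z₂` tops lie after the
last selected project. -/
def Feasible {ι : Type*} [Fintype ι] {m : ℕ} [NeZero m] (ψ : (ι → SPPref m) → Finset (Fin m))
    (x : Fin m) (z₁ z₂ : ℕ) : Prop :=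
  ∃ (Q : ι → SPPref m) (y : Fin m),
    IsLeast (ψ Q : Set (Fin m)) x ∧ IsGreatest (ψ Q : Set (Fin m)) y ∧
    (Finset.univ.filter fun i => (Q i).top < x).card = z₁ ∧
    (Finset.univ.filter fun i => y < (Q i).top).card + z₂ = Fintype.card ι

/-- The condition on the weights: whenever `γ` dominates `γ'` and `x` is feasible at
`(γ'_q, γ_q; ψ_q)`, the components whose parameter at `γ'` is not before `x` and whose parameter
at `γ` is not after the project `κ_q - 1` places behind `x` have a total weight of at least `η_q`. -/
def RandomGroupMinMax.WeightCondition {n m g : ℕ} [NeZero m] {grp : Fin n → Fin g}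
    {φ : RSCR n m} (D : RandomGroupMinMax grp φ) (κ : Fin g → ℕ) (ψ : RepScenario m grp)
    (η : Fin g → ℝ) : Prop :=
  ∀ (q : Fin g) (γ γ' : Gam grp), γ' ≤ γ → ∀ x : Fin m,
    Feasible (ψ q) x (γ' q : ℕ) (γ q : ℕ) →
      η q ≤ ∑ w ∈ Finset.univ.filter
        (fun w => x ≤ D.param w γ' ∧ (D.param w γ : ℕ) ≤ (x : ℕ) + κ q - 1), D.weight w

end GroupFair

open GroupFair

/-! The argument rests on cumulative probabilities. Under strategy-proofness and unanimity, the
probability of the projects up to `k` depends only on which voters have their top at or before `k`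
(`StrategyProof.probSet_Iic_eq`). This is proved by moving one preference to another through
adjacent swaps that stay single-peaked (`SPPref.swap_induction`). Group-wise anonymity leaves only
the tally, the number of such voters in each group. Hence `φ` is encoded by functions `F γ k`,
monotone in both arguments, which are read off at profiles whose tops are all extreme.

A deterministic group min-max rule is encoded the same way: `f P ≤ k` iff `β (tally grp P k) ≤ k`
(`IsGroupMinMaxWith.le_iff`). Cutting `F` at a level `u` and taking the first `k` with `u ≤ F γ k`
therefore gives parameters of a group min-max rule. Mixing over finitely many levels, weighted by
the gaps between consecutive values of `F`, recovers `φ` (`nonempty_randomGroupMinMax`).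

For any representation, the probability of an interval is a total weight of the kind in the weight
condition (`RandomGroupMinMax.probSet_Icc_eq`). So the guarantee and the condition are equivalent
representation by representation (`RandomGroupMinMax.weakGEG_iff`). -/

namespace GroupFair

/-! ### Single-peaked orders and adjacent swaps -/

namespace SPPref

variable {m : ℕ}

theorem eq_of_rel_imp {r s : SPPref m} (h : ∀ x y, r.rel x y → s.rel x y) : r = s := by
  have key : r.rel = s.rel := by
    funext x y
    refine propext ⟨h x y, fun hs => ?_⟩
    rcases r.total x y with hr | hr
    · exact hr
    · rw [s.antisymm x y hs (h y x hr)]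
      exact r.refl y
  cases r
  cases s
  cases key
  rfl

theorem rel_iff_card_upper_le (r : SPPref m) (p q : Fin m) :
    r.rel p q ↔ (r.upper p).card ≤ (r.upper q).card := by
  have hsub : ∀ {p q}, r.rel p q → r.upper p ⊆ r.upper q := fun {p q} h x hx => by
    simp only [upper, Finset.mem_filter, Finset.mem_univ, true_and] at hx ⊢
    exact r.trans _ _ _ hx h
  refine ⟨fun h => Finset.card_le_card (hsub h), fun h => ?_⟩
  by_contra hn
  have hq : r.rel q p := (r.total p q).resolve_left hn
  refine absurd h (not_le.2 (Finset.card_lt_card ⟨hsub hq, fun h' => hn ?_⟩))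
  have : p ∈ r.upper p := by simp [upper, r.refl]
  simpa [upper] using h' this

theorem exists_best (r : SPPref m) {s : Finset (Fin m)} (hs : s.Nonempty) :
    ∃ t ∈ s, ∀ p ∈ s, r.rel t p := by
  simpa only [rel_iff_card_upper_le] using
    Finset.exists_min_image s (fun p => (r.upper p).card) hs

theorem exists_worst (r : SPPref m) {s : Finset (Fin m)} (hs : s.Nonempty) :
    ∃ t ∈ s, ∀ p ∈ s, r.rel p t := by
  simpa only [rel_iff_card_upper_le] using
    Finset.exists_max_image s (fun p => (r.upper p).card) hs

/-- `v` arises from `u` by moving `d` above `c`, without any other change. -/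
def IsSwap (u v : SPPref m) (c d : Fin m) : Prop :=
  c ≠ d ∧ u.rel c d ∧ ∀ x y, v.rel x y ↔ (u.rel x y ∧ ¬(x = c ∧ y = d)) ∨ (x = d ∧ y = c)

namespace IsSwap

variable {u v : SPPref m} {c d : Fin m}

theorem rel_right (h : IsSwap u v c d) : v.rel d c := (h.2.2 d c).2 (Or.inr ⟨rfl, rfl⟩)

theorem not_rel_left (h : IsSwap u v c d) : ¬ u.rel d c :=
  fun hd => h.1 (u.antisymm _ _ h.2.1 hd)

theorem rel_iff (h : IsSwap u v c d) {x y : Fin m} (h1 : ¬(x = c ∧ y = d))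
    (h2 : ¬(x = d ∧ y = c)) : v.rel x y ↔ u.rel x y := by
  rw [h.2.2 x y]
  tauto

end IsSwap

variable [NeZero m]

theorem top_eq (r : SPPref m) {t : Fin m} (h : ∀ p, r.rel t p) : r.top = t :=
  r.antisymm _ _ (r.rel_top t) (h _)

theorem rel_of_between (r : SPPref m) {p q : Fin m}
    (h : (r.top ≤ p ∧ p ≤ q) ∨ (q ≤ p ∧ p ≤ r.top)) : r.rel p q := by
  by_cases h1 : p = r.top
  · exact h1 ▸ r.rel_top q
  by_cases h2 : p = q
  · exact h2 ▸ r.refl p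
  refine (r.singlePeaked r.top r.rel_top p q ?_).1
  rcases h with ⟨h3, h4⟩ | ⟨h3, h4⟩
  · exact Or.inl ⟨lt_of_le_of_ne h3 (Ne.symm h1), lt_of_le_of_ne h4 h2⟩
  · exact Or.inr ⟨lt_of_le_of_ne h3 (Ne.symm h2), lt_of_le_of_ne h4 h1⟩

/-- The middle one of three projects is not the worst one. -/
theorem rel_middle (r : SPPref m) {x p y : Fin m} (h1 : x < p) (h2 : p < y) :
    r.rel p x ∨ r.rel p y := by
  rcases le_total r.top p with h | h
  · exact Or.inr (r.rel_of_between (Or.inl ⟨h, h2.le⟩))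
  · exact Or.inl (r.rel_of_between (Or.inr ⟨h1.le, h⟩))

/-- An order that differs from a target can be moved towards the target by one swap. -/
theorem exists_isSwap {u s : SPPref m} (hne : u ≠ s) :
    ∃ c d v, IsSwap u v c d ∧ s.rel d c := by
  classical
  -- Take `d` as the `u`-best project that has to overtake something on the way to `s`, and `c` as
  -- its immediate predecessor in `u`.
  have hex : (Finset.univ.filter fun d => ∃ c, c ≠ d ∧ u.rel c d ∧ s.rel d c).Nonempty := by
    by_contra hn
    refine hne (eq_of_rel_imp fun x y hxy => ?_)
    by_contra hs
    refine hn ⟨y, Finset.mem_filter.2 ⟨Finset.mem_univ _, x, ?_, hxy, ?_⟩⟩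
    · rintro rfl
      exact hs (s.refl _)
    · exact (s.total x y).resolve_left hs
  obtain ⟨d, hd, hbest⟩ := u.exists_best hex
  obtain ⟨c₀, hc₀d, hc₀, hsc₀⟩ := (Finset.mem_filter.1 hd).2
  obtain ⟨c, hc, hworst⟩ := u.exists_worst (s := Finset.univ.filter fun x => x ≠ d ∧ u.rel x d)
    ⟨c₀, Finset.mem_filter.2 ⟨Finset.mem_univ _, hc₀d, hc₀⟩⟩
  obtain ⟨hcd, hucd⟩ := (Finset.mem_filter.1 hc).2
  -- Otherwise `c` itself would have to overtake `e`, although it is `u`-better than `d`.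
  have hagree : ∀ e, u.rel e c → s.rel e c := by
    intro e he
    by_contra hs
    have hec : e ≠ c := by
      rintro rfl
      exact hs (s.refl _)
    have := hbest c (Finset.mem_filter.2
      ⟨Finset.mem_univ _, e, hec, he, (s.total e c).resolve_left hs⟩)
    exact hcd (u.antisymm _ _ hucd this)
  have hsdc : s.rel d c := s.trans _ _ _ hsc₀
    (hagree c₀ (hworst c₀ (Finset.mem_filter.2 ⟨Finset.mem_univ _, hc₀d, hc₀⟩)))
  have hadj : ∀ x, u.rel c x → u.rel x d → x = c ∨ x = d := by
    intro x h1 h2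
    by_cases hxd : x = d
    · exact Or.inr hxd
    · exact Or.inl (u.antisymm _ _
        (hworst x (Finset.mem_filter.2 ⟨Finset.mem_univ _, hxd, h2⟩)) h1)
  -- After the swap a middle project could become worst only if it is `c`, with `d` on one side and
  -- some `y` above `c` in `u` on the other. By `hagree`, `s` would then also rank `c` below both
  -- neighbours, contrary to single-peakedness of `s`.
  have hmid : ∀ p x y, ((x < p ∧ p < y) ∨ (y < p ∧ p < x)) → u.rel p x →
      ((u.rel p x ∧ ¬(p = c ∧ x = d)) ∨ (p = d ∧ x = c)) ∨
        ((u.rel p y ∧ ¬(p = c ∧ y = d)) ∨ (p = d ∧ y = c)) := by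
    intro p x y hb hpx
    by_cases hcase : p = c ∧ x = d
    · obtain ⟨rfl, rfl⟩ := hcase
      have hyx : y ≠ x := by
        rintro rfl
        rcases hb with hb | hb
        · exact absurd (hb.1.trans hb.2) (lt_irrefl _)
        · exact absurd (hb.1.trans hb.2) (lt_irrefl _)
      have hyp : y ≠ p := by
        rintro rfl
        rcases hb with hb | hb
        · exact lt_irrefl _ hb.2
        · exact lt_irrefl _ hb.1
      refine Or.inr (Or.inl ⟨?_, fun h => hyx h.2⟩)
      by_contra hn
      have hsy := hagree y ((u.total p y).resolve_left hn)
      have hmid : s.rel p x ∨ s.rel p y := by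
        rcases hb with hb | hb
        · exact s.rel_middle hb.1 hb.2
        · exact (s.rel_middle hb.1 hb.2).symm
      rcases hmid with h | h
      · exact hcd (s.antisymm _ _ h hsdc)
      · exact hyp (s.antisymm _ _ hsy h)
    · exact Or.inl (Or.inl ⟨hpx, hcase⟩)
  have hmid' : ∀ x p y, x < p → p < y →
      ((u.rel p x ∧ ¬(p = c ∧ x = d)) ∨ (p = d ∧ x = c)) ∨
        ((u.rel p y ∧ ¬(p = c ∧ y = d)) ∨ (p = d ∧ y = c)) := by
    intro x p y h1 h2
    rcases u.rel_middle h1 h2 with h | h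
    · exact hmid p x y (Or.inl ⟨h1, h2⟩) h
    · exact (hmid p y x (Or.inr ⟨h1, h2⟩) h).symm
  have hanti : ∀ p p', ((u.rel p p' ∧ ¬(p = c ∧ p' = d)) ∨ (p = d ∧ p' = c)) →
      ((u.rel p' p ∧ ¬(p' = c ∧ p = d)) ∨ (p' = d ∧ p = c)) → p = p' := by
    rintro p p' (⟨h1, h2⟩ | ⟨h1, h2⟩) (⟨h3, h4⟩ | ⟨h3, h4⟩)
    · exact u.antisymm _ _ h1 h3
    · exact absurd ⟨h4, h3⟩ h2
    · exact absurd ⟨h2, h1⟩ h4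
    · exact absurd (h4.symm.trans h1) hcd
  refine ⟨c, d, ⟨fun x y => (u.rel x y ∧ ¬(x = c ∧ y = d)) ∨ (x = d ∧ y = c), ?_, ?_, hanti,
    ?_, ?_⟩, ⟨hcd, hucd, fun x y => Iff.rfl⟩, hsdc⟩
  · exact fun p => Or.inl ⟨u.refl p, fun h => hcd (h.1.symm.trans h.2)⟩
  · intro p p'
    rcases u.total p p' with h | h
    · by_cases h' : p = c ∧ p' = d
      · exact Or.inr (Or.inr ⟨h'.2, h'.1⟩)
      · exact Or.inl (Or.inl ⟨h, h'⟩)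
    · by_cases h' : p' = c ∧ p = d
      · exact Or.inl (Or.inr ⟨h'.2, h'.1⟩)
      · exact Or.inr (Or.inl ⟨h, h'⟩)
  · rintro p p' p'' (⟨h1, h2⟩ | ⟨rfl, rfl⟩) (⟨h3, h4⟩ | ⟨rfl, rfl⟩)
    · by_cases h : p = c ∧ p'' = d
      · obtain ⟨rfl, rfl⟩ := h
        rcases hadj p' h1 h3 with h | h
        · exact absurd ⟨h, rfl⟩ h4
        · exact absurd ⟨rfl, h⟩ h2
      · exact Or.inl ⟨u.trans _ _ _ h1 h3, h⟩
    · by_cases h : p = p'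
      · exact Or.inr ⟨h, rfl⟩
      · refine Or.inl ⟨?_, fun h' => hcd h'.2⟩
        by_contra hn
        rcases hadj p ((u.total p p'').resolve_left hn) h1 with h' | h'
        · exact h2 ⟨h', rfl⟩
        · exact h h'
    · by_cases h : p'' = p'
      · exact Or.inr ⟨rfl, h⟩
      · refine Or.inl ⟨?_, fun h' => hcd h'.1.symm⟩
        by_contra hn
        rcases hadj p'' h3 ((u.total p p'').resolve_left hn) with h' | h'
        · exact h h'
        · exact h4 ⟨rfl, h'⟩
    · exact absurd rfl hcd
  · intro t ht p p' hb
    rcases hb with ⟨h1, h2⟩ | ⟨h1, h2⟩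
    · refine ⟨(hmid' t p p' h1 h2).resolve_left fun h => ?_, h2.ne⟩
      exact h1.ne (hanti _ _ (ht p) h)
    · refine ⟨(hmid' p' p t h1 h2).resolve_right fun h => ?_, h1.ne'⟩
      exact h2.ne' (hanti _ _ (ht p) h)

/-- A property passes from an order to a target if it is kept by swaps towards the target. -/
theorem swap_induction {s : SPPref m} {C : SPPref m → Prop}
    (step : ∀ u v c d, IsSwap u v c d → s.rel d c → C u → C v) (u : SPPref m) (hu : C u) : C s := by
  classical
  -- Each swap towards `s` removes exactly the disagreement `(c, d)` and creates none.
  induction hN : (Finset.univ.filter fun x : Fin m × Fin m =>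
      u.rel x.1 x.2 ∧ ¬ s.rel x.1 x.2).card using Nat.strong_induction_on generalizing u with
  | _ N ih =>
    by_cases hne : u = s
    · exact hne ▸ hu
    · obtain ⟨c, d, v, hv, hs⟩ := exists_isSwap hne
      have hcd : ¬ s.rel c d := fun h => hv.1 (s.antisymm _ _ h hs)
      refine ih _ ?_ v (step u v c d hv hs hu) rfl
      rw [← hN]
      refine Finset.card_lt_card ((Finset.ssubset_iff_of_subset fun x hx => ?_).2
        ⟨(c, d), ?_, ?_⟩)
      · simp only [Finset.mem_filter, Finset.mem_univ, true_and] at hx ⊢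
        refine ⟨?_, hx.2⟩
        rcases (hv.2.2 _ _).1 hx.1 with h | h
        · exact h.1
        · rw [h.1, h.2] at hx
          exact absurd hs hx.2
      · simp [hv.2.1, hcd]
      · simp only [Finset.mem_filter, Finset.mem_univ, true_and, not_and, not_not]
        exact fun h => absurd (v.antisymm _ _ h hv.rel_right) hv.1

namespace IsSwap

variable {u v s : SPPref m} {c d : Fin m}

theorem top_eq_or (h : IsSwap u v c d) : u.top = v.top ∨ (u.top = c ∧ v.top = d) := by
  by_cases hc : u.top = c ∧ v.top = d
  · exact Or.inr hc
  · refine Or.inl (u.antisymm _ _ (u.rel_top _) ?_)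
    rcases (h.2.2 _ _).1 (v.rel_top u.top) with h' | h'
    · exact h'.1
    · exact absurd ⟨h'.2, h'.1⟩ hc

/-- A swap towards `s` moves the top towards the top of `s`. -/
theorem top_between (h : IsSwap u v c d) (hs : s.rel d c) :
    (u.top ≤ v.top ∧ v.top ≤ s.top) ∨ (s.top ≤ v.top ∧ v.top ≤ u.top) := by
  rcases h.top_eq_or with h' | ⟨h1, h2⟩
  · rw [h']
    rcases le_total v.top s.top with h'' | h''
    · exact Or.inl ⟨le_rfl, h''⟩
    · exact Or.inr ⟨h'', le_rfl⟩
  · have hscd : ¬ s.rel c d := fun h' => h.1 (s.antisymm _ _ h' hs)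
    -- Since `d` is on top after the swap, only `c` beats it in `u`. If the new top overshot the top
    -- of `s`, then either `s` would rank `c` above `d`, or the top of `s` would lie strictly
    -- between `c` and `d` and so beat `d` in `u`.
    have key : ∀ e, e ≠ c → e ≠ d → ¬ u.rel e d := by
      intro e hc hd he
      have : v.rel e d := (h.2.2 _ _).2 (Or.inl ⟨he, fun h' => hc h'.1⟩)
      exact hd (v.antisymm _ _ this (h2 ▸ v.rel_top e))
    rw [h1, h2]
    rcases lt_or_gt_of_ne h.1 with hlt | hlt
    · refine Or.inl ⟨hlt.le, ?_⟩
      by_contra hn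
      rw [not_le] at hn
      rcases le_or_gt s.top c with h3 | h3
      · exact hscd (s.rel_of_between (Or.inl ⟨h3, hlt.le⟩))
      · exact key s.top h3.ne' hn.ne (u.rel_of_between (Or.inl ⟨h1 ▸ h3.le, hn.le⟩))
    · refine Or.inr ⟨?_, hlt.le⟩
      by_contra hn
      rw [not_le] at hn
      rcases le_or_gt c s.top with h3 | h3
      · exact hscd (s.rel_of_between (Or.inr ⟨hlt.le, h3⟩))
      · exact key s.top h3.ne hn.ne' (u.rel_of_between (Or.inr ⟨hn.le, h1 ▸ h3.le⟩))

end IsSwap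

end SPPref

/-! ### Distributions and coordinatewise changes of a profile -/

theorem prob_nonneg {m : ℕ} (d : stdSimplex ℝ (Fin m)) (p : Fin m) : 0 ≤ prob d p := d.2.1 p

theorem sum_prob {m : ℕ} (d : stdSimplex ℝ (Fin m)) : ∑ p, prob d p = 1 := d.2.2

theorem prob_eq_zero_of_ne {m : ℕ} {d : stdSimplex ℝ (Fin m)} {p q : Fin m} (h : prob d p = 1)
    (hq : q ≠ p) : prob d q = 0 := by
  have h1 := Finset.add_sum_erase Finset.univ (prob d) (Finset.mem_univ p)
  rw [sum_prob, h] at h1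
  have h2 : prob d q ≤ ∑ x ∈ Finset.univ.erase p, prob d x :=
    Finset.single_le_sum (fun x _ => prob_nonneg d x)
      (Finset.mem_erase.2 ⟨hq, Finset.mem_univ q⟩)
  linarith [prob_nonneg d q]

/-- A quantity that does not decrease when one coordinate moves along `R` does not decrease when
all coordinates do. -/
theorem le_of_forall_update_le {n : ℕ} {α : Type*} {E : (Fin n → α) → ℝ} {R : α → α → Prop}
    (h : ∀ P i s, R (P i) s → E P ≤ E (Function.update P i s)) {P Q : Fin n → α}
    (hPQ : ∀ i, R (P i) (Q i)) : E P ≤ E Q := by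
  classical
  have key : ∀ S : Finset (Fin n), E P ≤ E (fun i => if i ∈ S then Q i else P i) := by
    intro S
    induction S using Finset.induction_on with
    | empty => simp
    | insert a S ha ih =>
      refine ih.trans ((h _ a (Q a) (by simpa [ha] using hPQ a)).trans (le_of_eq ?_))
      congr 1
      funext i
      by_cases hi : i = a
      · subst hi
        simp
      · simp [hi]
  simpa using key Finset.univ

theorem eq_of_forall_update_eq {n : ℕ} {α : Type*} {E : (Fin n → α) → ℝ} {R : α → α → Prop}
    (h : ∀ P i s, R (P i) s → E P = E (Function.update P i s)) {P Q : Fin n → α}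
    (hPQ : ∀ i, R (P i) (Q i)) : E P = E Q :=
  le_antisymm (le_of_forall_update_le (fun P i s hs => (h P i s hs).le) hPQ)
    (neg_le_neg_iff.1 (le_of_forall_update_le (E := fun P => -E P) (R := R)
      (fun P i s hs => (neg_le_neg_iff.2 (h P i s hs).ge)) hPQ))

/-! ### Consequences of strategy-proofness and unanimity -/

section StrategyProof

variable {n m : ℕ} {φ : RSCR n m}

theorem StrategyProof.probSet_le (hφ : StrategyProof φ) (P : Fin n → SPPref m) (i : Fin n)
    (r : SPPref m) {A : Finset (Fin m)} (hA : ∀ x ∈ A, ∀ y, r.rel y x → y ∈ A) :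
    probSet (φ P) A ≤ probSet (φ (Function.update P i r)) A := by
  rcases A.eq_empty_or_nonempty with rfl | hne
  · simp [probSet]
  · obtain ⟨t, ht, hw⟩ := r.exists_worst hne
    have hAt : A = r.upper t := by
      ext x
      simp only [SPPref.upper, Finset.mem_filter, Finset.mem_univ, true_and]
      exact ⟨hw x, hA t ht x⟩
    -- The true preference is `r`, and the old `P i` serves as the misreport.
    have := hφ i (Function.update P i r) (P i) t
    rw [Function.update_self, Function.update_idem, Function.update_eq_self] at this
    rw [hAt]
    exact this

theorem StrategyProof.probSet_eq (hφ : StrategyProof φ) (P : Fin n → SPPref m) (i : Fin n)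
    {r r' : SPPref m} {A : Finset (Fin m)} (hA : ∀ x ∈ A, ∀ y, r.rel y x → y ∈ A)
    (hA' : ∀ x ∈ A, ∀ y, r'.rel y x → y ∈ A) :
    probSet (φ (Function.update P i r)) A = probSet (φ (Function.update P i r')) A := by
  have h1 := hφ.probSet_le (Function.update P i r) i r' hA'
  have h2 := hφ.probSet_le (Function.update P i r') i r hA
  rw [Function.update_idem] at h1 h2
  exact le_antisymm h1 h2

/-- The upper contour set of `a`, with or without `a`, is upward closed for both `u` and `v`. Its
probability is thus the same at both reports, and subtracting isolates `a`. -/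
theorem StrategyProof.prob_eq_of_isSwap (hφ : StrategyProof φ) (P : Fin n → SPPref m) (i : Fin n)
    {u v : SPPref m} {c d a : Fin m} (h : u.IsSwap v c d) (hc : a ≠ c) (hd : a ≠ d) :
    prob (φ (Function.update P i u)) a = prob (φ (Function.update P i v)) a := by
  classical
  have hrel : ∀ x, v.rel x a ↔ u.rel x a := fun x =>
    h.rel_iff (fun h' => hd h'.2) (fun h' => hc h'.2)
  have h1 := hφ.probSet_eq P i (r := u) (r' := v) (A := Finset.univ.filter fun x => u.rel x a)
    (fun x hx y hy => by
      simp only [Finset.mem_filter, Finset.mem_univ, true_and] at hx ⊢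
      exact u.trans _ _ _ hy hx)
    (fun x hx y hy => by
      simp only [Finset.mem_filter, Finset.mem_univ, true_and, ← hrel] at hx ⊢
      exact v.trans _ _ _ hy hx)
  have h2 := hφ.probSet_eq P i (r := u) (r' := v)
    (A := (Finset.univ.filter fun x => u.rel x a).erase a)
    (fun x hx y hy => by
      simp only [Finset.mem_erase, Finset.mem_filter, Finset.mem_univ, true_and] at hx ⊢
      refine ⟨?_, u.trans _ _ _ hy hx.2⟩
      rintro rfl
      exact hx.1 (u.antisymm _ _ hx.2 hy))
    (fun x hx y hy => by
      simp only [Finset.mem_erase, Finset.mem_filter, Finset.mem_univ, true_and, ← hrel] at hx ⊢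
      refine ⟨?_, v.trans _ _ _ hy hx.2⟩
      rintro rfl
      exact hx.1 (v.antisymm _ _ hx.2 hy))
  have ha : a ∈ Finset.univ.filter fun x => u.rel x a := by simp [u.refl]
  unfold probSet at h1 h2
  rw [← Finset.add_sum_erase _ _ ha, ← Finset.add_sum_erase _ _ ha] at h1
  linarith

theorem StrategyProof.prob_add_eq_of_isSwap (hφ : StrategyProof φ) (P : Fin n → SPPref m)
    (i : Fin n) {u v : SPPref m} {c d : Fin m} (h : u.IsSwap v c d) :
    prob (φ (Function.update P i u)) c + prob (φ (Function.update P i u)) d =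
      prob (φ (Function.update P i v)) c + prob (φ (Function.update P i v)) d := by
  have key : ∀ e : stdSimplex ℝ (Fin m), prob e c + prob e d +
      ∑ x ∈ (Finset.univ.erase c).erase d, prob e x = 1 := by
    intro e
    rw [add_assoc, Finset.add_sum_erase _ _ (Finset.mem_erase.2 ⟨h.1.symm, Finset.mem_univ d⟩),
      Finset.add_sum_erase _ _ (Finset.mem_univ c), sum_prob]
  have h1 := key (φ (Function.update P i u))
  have h2 := key (φ (Function.update P i v))
  rw [Finset.sum_congr rfl fun x hx => hφ.prob_eq_of_isSwap P i h
    (Finset.ne_of_mem_erase (Finset.mem_of_mem_erase hx)) (Finset.ne_of_mem_erase hx)] at h1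
  linarith

variable [NeZero m]

/-- A swap that keeps the top does not change the outcome. -/
theorem StrategyProof.prob_eq_of_isSwap_of_top_eq (hφ : StrategyProof φ) (hun : Unanimous φ)
    (P : Fin n → SPPref m) (i : Fin n) {r r' : SPPref m} {a b : Fin m} (h : r.IsSwap r' a b)
    (htop : r.top = r'.top) :
    prob (φ (Function.update P i r)) a = prob (φ (Function.update P i r')) a := by
  classical
  -- `E` is the mass that the swap by voter `i` takes from `a`, equivalently the mass it gives to
  -- `b`. It will turn out to depend only on how the other voters compare `a` and `b`.
  set E : (Fin n → SPPref m) → ℝ := fun Q =>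
    prob (φ (Function.update Q i r)) a - prob (φ (Function.update Q i r')) a with hE
  have hE' : ∀ Q, E Q =
      prob (φ (Function.update Q i r')) b - prob (φ (Function.update Q i r)) b := fun Q => by
    have := hφ.prob_add_eq_of_isSwap Q i h
    simp only [hE]
    linarith
  have step : ∀ Q j s, ((Q j).rel a b ↔ s.rel a b) → E Q = E (Function.update Q j s) := by
    intro Q j s hs
    by_cases hij : j = i
    · subst hij
      simp [hE]
    refine (SPPref.swap_induction (s := s)
      (C := fun u => (u.rel a b ↔ s.rel a b) ∧ E Q = E (Function.update Q j u)) ?_ (Q j)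
      ⟨hs, by rw [Function.update_eq_self]⟩).2
    rintro u v c d huv hsdc ⟨hab, hEu⟩
    have hscd : ¬ s.rel c d := fun h' => huv.1 (s.antisymm _ _ h' hsdc)
    have hn1 : ¬ (a = c ∧ b = d) := by
      rintro ⟨rfl, rfl⟩
      exact hscd (hab.1 huv.2.1)
    have hn2 : ¬ (a = d ∧ b = c) := by
      rintro ⟨rfl, rfl⟩
      exact huv.not_rel_left (hab.2 hsdc)
    refine ⟨(huv.rel_iff hn1 hn2).trans hab, hEu.trans ?_⟩
    have hcomm : ∀ (w t : SPPref m), Function.update (Function.update Q j w) i t =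
        Function.update (Function.update Q i t) j w := fun w t => Function.update_comm hij _ _ _
    -- The swapped pair is not `{a, b}`, so it misses `a` or `b`; `E` is computed from the missed
    -- project, whose probability the swap does not affect.
    by_cases hac : a ≠ c ∧ a ≠ d
    · simp only [hE, hcomm]
      rw [hφ.prob_eq_of_isSwap _ j huv hac.1 hac.2, hφ.prob_eq_of_isSwap _ j huv hac.1 hac.2]
    · have hb : b ≠ c ∧ b ≠ d := by
        have := h.1
        constructor
        · rintro rfl
          tauto
        · rintro rfl
          tauto
      rw [hE', hE']
      simp only [hcomm]
      rw [hφ.prob_eq_of_isSwap _ j huv hb.1 hb.2, hφ.prob_eq_of_isSwap _ j huv hb.1 hb.2]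
  have hr' : ¬ r'.rel a b := fun h' => h.1 (r'.antisymm _ _ h' h.rel_right)
  -- Both comparisons of `a` and `b` are available among `r` and `r'`, which share a top. So the
  -- profile can be made unanimous without changing `E`, and there `E` vanishes.
  have hPQ : E P = E (fun j => if (P j).rel a b then r else r') := by
    refine eq_of_forall_update_eq (R := fun u s => u.rel a b ↔ s.rel a b) step fun j => ?_
    by_cases hj : (P j).rel a b
    · simp [hj, h.2.1]
    · simp [hj, hr']
  have hzero : ∀ w : SPPref m, w.top = r.top → ∀ j,
      (Function.update (fun j => if (P j).rel a b then r else r') i w j).top = r.top := by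
    intro w hw j
    by_cases hj : j = i
    · subst hj
      simpa using hw
    · rw [Function.update_of_ne hj]
      split_ifs
      · rfl
      · exact htop.symm
  have h1 := hun _ _ (hzero r rfl)
  have h2 := hun _ _ (hzero r' htop.symm)
  have hE0 : E (fun j => if (P j).rel a b then r else r') = 0 := by
    simp only [hE]
    by_cases ha : a = r.top
    · subst ha
      rw [h1, h2, sub_self]
    · rw [prob_eq_zero_of_ne h1 ha, prob_eq_zero_of_ne h2 ha, sub_self]
  rw [hE0] at hPQ
  exact sub_eq_zero.1 hPQ

/-- A swap below the top changes nothing. A swap at the top only moves mass between the old and the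
new top, which lie on the same side of the cut at `k`. -/
theorem StrategyProof.probSet_Iic_eq_of_isSwap (hφ : StrategyProof φ) (hun : Unanimous φ)
    (P : Fin n → SPPref m) (i : Fin n) {u v : SPPref m} {c d k : Fin m} (h : u.IsSwap v c d)
    (htop : u.top ≤ k ↔ v.top ≤ k) :
    probSet (φ (Function.update P i u)) (Finset.Iic k) =
      probSet (φ (Function.update P i v)) (Finset.Iic k) := by
  have hadd := hφ.prob_add_eq_of_isSwap P i h
  rcases h.top_eq_or with ht | ⟨rfl, rfl⟩
  · have hc := hφ.prob_eq_of_isSwap_of_top_eq hun P i h ht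
    refine Finset.sum_congr rfl fun x _ => ?_
    by_cases hxc : x = c
    · rw [hxc, hc]
    by_cases hxd : x = d
    · rw [hxd]
      linarith
    exact hφ.prob_eq_of_isSwap P i h hxc hxd
  · by_cases hk : u.top ≤ k
    · have hu : u.top ∈ Finset.Iic k := Finset.mem_Iic.2 hk
      have hv : v.top ∈ (Finset.Iic k).erase u.top :=
        Finset.mem_erase.2 ⟨h.1.symm, Finset.mem_Iic.2 (htop.1 hk)⟩
      unfold probSet
      rw [← Finset.add_sum_erase _ _ hu, ← Finset.add_sum_erase _ _ hu,
        ← Finset.add_sum_erase _ _ hv, ← Finset.add_sum_erase _ _ hv, ← add_assoc, ← add_assoc,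
        hadd]
      congr 1
      exact Finset.sum_congr rfl fun x hx => hφ.prob_eq_of_isSwap P i h
        (Finset.ne_of_mem_erase (Finset.mem_of_mem_erase hx)) (Finset.ne_of_mem_erase hx)
    · refine Finset.sum_congr rfl fun x hx => hφ.prob_eq_of_isSwap P i h ?_ ?_
      · rintro rfl
        exact hk (Finset.mem_Iic.1 hx)
      · rintro rfl
        exact hk (htop.2 (Finset.mem_Iic.1 hx))

/-- The probability of the first projects up to `k` depends only on which tops are not after
`k`. -/
theorem StrategyProof.probSet_Iic_eq (hφ : StrategyProof φ) (hun : Unanimous φ)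
    {P Q : Fin n → SPPref m} {k : Fin m} (hPQ : ∀ i, (P i).top ≤ k ↔ (Q i).top ≤ k) :
    probSet (φ P) (Finset.Iic k) = probSet (φ Q) (Finset.Iic k) := by
  refine eq_of_forall_update_eq (E := fun P => probSet (φ P) (Finset.Iic k))
    (R := fun u s => u.top ≤ k ↔ s.top ≤ k) (fun P i s hs => ?_) hPQ
  refine (SPPref.swap_induction (s := s)
    (C := fun u => (u.top ≤ k ↔ s.top ≤ k) ∧ probSet (φ P) (Finset.Iic k) =
      probSet (φ (Function.update P i u)) (Finset.Iic k)) ?_ (P i)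
    ⟨hs, by rw [Function.update_eq_self]⟩).2
  rintro u v c d huv hsdc ⟨hus, heq⟩
  -- The top moves monotonically towards its target, so it cannot cross `k` when both ends are on
  -- the same side.
  have hvs : v.top ≤ k ↔ s.top ≤ k := by
    rcases huv.top_between hsdc with ⟨h1, h2⟩ | ⟨h1, h2⟩
    · exact ⟨fun h => hus.1 (h1.trans h), fun h => h2.trans h⟩
    · exact ⟨fun h => h1.trans h, fun h => h2.trans (hus.2 h)⟩
  exact ⟨hvs, heq.trans (hφ.probSet_Iic_eq_of_isSwap hun P i huv (hus.trans hvs.symm))⟩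

/-- Every initial segment is an upper contour set for a voter whose top is the first project. This
is the source of monotonicity of the parameters. -/
theorem StrategyProof.probSet_Iic_le (hφ : StrategyProof φ) {P Q : Fin n → SPPref m}
    (hPQ : ∀ i, P i = Q i ∨ (Q i).top = ⊥) (k : Fin m) :
    probSet (φ P) (Finset.Iic k) ≤ probSet (φ Q) (Finset.Iic k) := by
  refine le_of_forall_update_le (E := fun P => probSet (φ P) (Finset.Iic k))
    (R := fun u s => u = s ∨ s.top = ⊥) (fun P i s hs => ?_) hPQ
  rcases hs with rfl | hs
  · simp
  · refine hφ.probSet_le P i s fun x hx y hyx => ?_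
    rw [Finset.mem_Iic] at hx ⊢
    by_contra hn
    have hxy : x < y := hx.trans_lt (not_le.1 hn)
    exact hxy.ne (s.antisymm _ _ (s.rel_of_between (Or.inl ⟨hs ▸ bot_le, hxy.le⟩)) hyx)

end StrategyProof

/-! ### Preferences with a prescribed top -/

theorem SPPref.exists_top_eq {m : ℕ} [NeZero m] (t : Fin m) : ∃ r : SPPref m, r.top = t := by
  -- Rank by distance from `t`, with ties going to the right: even keys on the left and odd keys on
  -- the right make the ranking strict.
  let key : Fin m → ℤ := fun p =>
    if (p : ℤ) ≤ t then 2 * ((t : ℤ) - p) else 2 * ((p : ℤ) - t) - 1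
  have hinj : ∀ p q, key p = key q → p = q := by
    intro p q h
    apply Fin.ext
    simp only [key] at h
    split_ifs at h <;> omega
  have ht : ∀ p, key t ≤ key p := by
    intro p
    simp only [key]
    split_ifs <;> omega
  refine ⟨⟨fun p q => key p ≤ key q, fun p => le_rfl, fun p q => le_total _ _,
    fun p q h1 h2 => hinj _ _ (le_antisymm h1 h2), fun p q r h1 h2 => h1.trans h2, ?_⟩,
    SPPref.top_eq _ ht⟩
  intro s hs p q h
  obtain rfl : s = t := hinj _ _ (le_antisymm (hs t) (ht s))
  simp only [key, Fin.lt_def] at h ⊢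
  refine ⟨?_, ?_⟩
  · split_ifs <;> omega
  · rintro rfl
    omega

/-- A preference with a prescribed top. -/
noncomputable def prefOfTop {m : ℕ} [NeZero m] (t : Fin m) : SPPref m :=
  (SPPref.exists_top_eq t).choose

@[simp]
theorem top_prefOfTop {m : ℕ} [NeZero m] (t : Fin m) : (prefOfTop t).top = t :=
  (SPPref.exists_top_eq t).choose_spec

/-- The first project with a property that passes on to later projects. -/
theorem inf_filter_le_iff {m : ℕ} [NeZero m] {p : Fin m → Prop} [DecidablePred p]
    (hmono : ∀ a b, a ≤ b → p a → p b) (htop : p ⊤) (k : Fin m) :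
    (Finset.univ.filter p).inf id ≤ k ↔ p k := by
  refine ⟨fun h => ?_, fun h => Finset.inf_le (f := id) (by simpa using h)⟩
  rcases eq_or_ne k ⊤ with rfl | hk
  · exact htop
  · obtain ⟨a, ha, hak⟩ := (Finset.inf_le_iff (lt_top_iff_ne_top.2 hk)).1 h
    exact hmono a k hak (Finset.mem_filter.1 ha).2

/-! ### Group tallies and the cumulative form of group min-max rules -/

section Tally

variable {n m g : ℕ} [NeZero m] (grp : Fin n → Fin g)

/-- The numbers of members of the groups that have a property. -/
noncomputable def countWith (p : Fin n → Prop) [DecidablePred p] : Gam grp := fun q =>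
  ⟨(Finset.univ.filter fun i : Members grp q => p i.1).card,
    Nat.lt_succ_of_le (Finset.card_le_univ _)⟩

theorem countWith_mono {p p' : Fin n → Prop} [DecidablePred p] [DecidablePred p']
    (h : ∀ i, p i → p' i) : countWith grp p ≤ countWith grp p' := by
  intro q
  change (Finset.univ.filter fun i : Members grp q => p i.1).card ≤
    (Finset.univ.filter fun i : Members grp q => p' i.1).card
  exact Finset.card_le_card fun i hi => Finset.mem_filter.2
    ⟨Finset.mem_univ _, h _ (Finset.mem_filter.1 hi).2⟩

theorem countWith_congr {p p' : Fin n → Prop} [DecidablePred p] [DecidablePred p']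
    (h : ∀ i, p i ↔ p' i) : countWith grp p = countWith grp p' :=
  le_antisymm (countWith_mono grp fun i => (h i).1) (countWith_mono grp fun i => (h i).2)

theorem countWith_eq_top {p : Fin n → Prop} [DecidablePred p] (h : ∀ i, p i) :
    countWith grp p = ⊤ := by
  refine top_unique fun q => ?_
  rw [Fin.le_def]
  have : Finset.univ.filter (fun i : Members grp q => p i.1) = Finset.univ := by simp [h]
  simp only [countWith, this, Finset.card_univ]
  exact Nat.lt_succ_iff.1 ((⊤ : Gam grp) q).2

theorem countWith_eq_bot {p : Fin n → Prop} [DecidablePred p] (h : ∀ i, ¬ p i) :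
    countWith grp p = ⊥ := by
  refine bot_unique fun q => ?_
  rw [Fin.le_def]
  simp [countWith, h]

/-- The position of a voter in an enumeration of its group. -/
noncomputable def pos (i : Fin n) : ℕ := Fintype.equivFin (Members grp (grp i)) ⟨i, rfl⟩

/-- Provides, for every `γ`, a concrete set of voters with these group counts; these sets are nested
as `γ` grows. -/
theorem countWith_pos_lt (γ : Gam grp) : countWith grp (fun i => pos grp i < γ (grp i)) = γ := by
  funext q
  apply Fin.ext
  have h1 : (Finset.univ.filter fun i : Members grp q => pos grp i.1 < γ (grp i.1)) =
      Finset.univ.filter fun i : Members grp q =>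
        ((Fintype.equivFin (Members grp q) i : Fin _) : ℕ) < γ q := by
    refine Finset.filter_congr fun i _ => ?_
    obtain ⟨i, rfl⟩ := i
    rfl
  have h2 : (Finset.univ.filter fun i : Members grp q =>
      ((Fintype.equivFin (Members grp q) i : Fin _) : ℕ) < γ q).card =
      (Finset.univ.filter fun j : Fin (Fintype.card (Members grp q)) => (j : ℕ) < γ q).card :=
    Finset.card_bij (fun i _ => Fintype.equivFin (Members grp q) i)
      (fun i hi => by simpa using hi) (fun i _ j _ h => (Fintype.equivFin _).injective h)
      (fun j hj => ⟨(Fintype.equivFin _).symm j, by simpa using hj, by simp⟩)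
  change (Finset.univ.filter fun i : Members grp q => pos grp i.1 < γ (grp i.1)).card = _
  rw [h1, h2, Fin.card_filter_val_lt]
  exact min_eq_right (Nat.lt_succ_iff.1 (γ q).2)

/-- The voters of each group with and without the property are equinumerous for `p` and `p'`;
bijections between these classes glue to a permutation. -/
theorem exists_perm_of_countWith_eq {p p' : Fin n → Prop} [DecidablePred p] [DecidablePred p']
    (h : countWith grp p = countWith grp p') :
    ∃ π : Equiv.Perm (Fin n), (∀ i, grp (π i) = grp i) ∧ ∀ i, p (π i) ↔ p' i := by
  have hcard : ∀ (p : Fin n → Prop) [DecidablePred p] (q : Fin g),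
      (Finset.univ.filter fun i => grp i = q ∧ p i).card = countWith grp p q := by
    intro p _ q
    change _ = (Finset.univ.filter fun i : Members grp q => p i.1).card
    refine (Finset.card_bij (fun (i : Members grp q) _ => i.1) ?_ ?_ ?_).symm
    · intro i hi
      simpa [i.2] using hi
    · exact fun i _ j _ hij => Subtype.ext hij
    · intro i hi
      simp only [Finset.mem_filter, Finset.mem_univ, true_and] at hi
      exact ⟨⟨i, hi.1⟩, by simpa using hi.2, rfl⟩
  have hfib : ∀ c : Fin g × Bool, Nonempty ({i // (grp i, decide (p' i)) = c} ≃
      {i // (grp i, decide (p i)) = c}) := by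
    rintro ⟨q, b⟩
    have hq : (countWith grp p' q : ℕ) = countWith grp p q := by rw [h]
    rw [← hcard, ← hcard] at hq
    refine ⟨Fintype.equivOfCardEq ?_⟩
    rw [Fintype.card_subtype, Fintype.card_subtype]
    cases b with
    | true => simpa using hq
    | false =>
      have h1 := Finset.card_filter_add_card_filter_not
        (s := Finset.univ.filter fun i => grp i = q) (fun i => p i)
      have h2 := Finset.card_filter_add_card_filter_not
        (s := Finset.univ.filter fun i => grp i = q) (fun i => p' i)
      simp only [Finset.filter_filter] at h1 h2
      simp only [Prod.mk.injEq, decide_eq_false_iff_not]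
      omega
  let e := fun c => (hfib c).some
  refine ⟨Equiv.ofFiberEquiv e, fun i => ?_, fun i => ?_⟩
  · exact congrArg Prod.fst (Equiv.ofFiberEquiv_map e i)
  · have := congrArg Prod.snd (Equiv.ofFiberEquiv_map e i)
    simpa using this

/-- The numbers of tops of the groups that are not after `k`. -/
noncomputable def tally (P : Fin n → SPPref m) (k : Fin m) : Gam grp :=
  countWith grp fun i => (P i).top ≤ k

/-- The numbers of tops of the groups that are before `x`. -/
noncomputable def tallyLt (P : Fin n → SPPref m) (x : Fin m) : Gam grp :=
  countWith grp fun i => (P i).top < x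

variable {grp}

theorem tally_mono (P : Fin n → SPPref m) {k l : Fin m} (h : k ≤ l) :
    tally grp P k ≤ tally grp P l :=
  countWith_mono grp fun _ hi => le_trans hi h

theorem tau_le_iff {γ : Gam grp} {P : Fin n → SPPref m} {q : Fin g} {k : Fin m} :
    tau (γ q : ℕ) (restrict grp P q) ≤ k ↔ γ q ≤ tally grp P k q := by
  unfold tau
  rw [inf_filter_le_iff (p := fun k =>
    (γ q : ℕ) ≤ (Finset.univ.filter fun i => (restrict grp P q i).top ≤ k).card)]
  · rfl
  · exact fun a b hab h => h.trans (tally_mono (grp := grp) P hab q)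
  · simpa [restrict] using Nat.lt_succ_iff.1 (γ q).2

/-- The order statistics for `γ` are all at most `k` exactly when `γ` is below the tally at `k`. As
`β` is antitone, the tally itself is the best such choice, so the minimum over `γ` disappears. -/
theorem groupMinMax_le_iff {β : Gam grp → Fin m} (hβ : ∀ γ γ', γ' ≤ γ → β γ ≤ β γ')
    (P : Fin n → SPPref m) (k : Fin m) :
    (Finset.univ.inf fun γ : Gam grp =>
      max (Finset.univ.sup fun q => tau (γ q : ℕ) (restrict grp P q)) (β γ)) ≤ k ↔
      β (tally grp P k) ≤ k := by
  rcases eq_or_ne k ⊤ with rfl | hk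
  · simp
  rw [Finset.inf_le_iff (lt_top_iff_ne_top.2 hk)]
  simp only [Finset.mem_univ, true_and, max_le_iff, Finset.sup_le_iff, forall_const, tau_le_iff]
  exact ⟨fun ⟨γ, h1, h2⟩ => (hβ _ _ h1).trans h2, fun h => ⟨_, fun _ => le_rfl, h⟩⟩

theorem IsGroupMinMaxWith.le_iff {f : DSCR n m} {β : Gam grp → Fin m}
    (h : IsGroupMinMaxWith grp f β) (P : Fin n → SPPref m) (k : Fin m) :
    f P ≤ k ↔ β (tally grp P k) ≤ k := by
  rw [h.2.2.2 P]
  exact groupMinMax_le_iff h.2.2.1 P k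

theorem isGroupMinMaxWith_of_le_iff {f : DSCR n m} {β : Gam grp → Fin m} (hbot : β ⊥ = ⊤)
    (htop : β ⊤ = ⊥) (hβ : ∀ γ γ', γ' ≤ γ → β γ ≤ β γ')
    (h : ∀ P k, f P ≤ k ↔ β (tally grp P k) ≤ k) : IsGroupMinMaxWith grp f β :=
  ⟨hbot, htop, hβ, fun P => eq_of_forall_ge_iff fun k =>
    (h P k).trans (groupMinMax_le_iff hβ P k).symm⟩

theorem lt_iff_exists_le {x : Fin m} (hx : x ≠ ⊥) : ∃ k : Fin m, ∀ y : Fin m, y < x ↔ y ≤ k := by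
  have hx0 : 0 < (x : ℕ) := by
    rw [Nat.pos_iff_ne_zero]
    intro h0
    exact hx (bot_unique (by rw [Fin.le_def, h0]; exact Nat.zero_le _))
  refine ⟨⟨x - 1, by omega⟩, fun y => ?_⟩
  rw [Fin.lt_def, Fin.le_def]
  simp only
  omega

theorem IsGroupMinMaxWith.lt_iff {f : DSCR n m} {β : Gam grp → Fin m}
    (h : IsGroupMinMaxWith grp f β) (P : Fin n → SPPref m) (x : Fin m) :
    f P < x ↔ β (tallyLt grp P x) < x := by
  rcases eq_or_ne x ⊥ with rfl | hx
  · simp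
  · obtain ⟨k, hk⟩ := lt_iff_exists_le hx
    rw [hk, hk, h.le_iff, tally, tallyLt, countWith_congr grp fun i => hk _]

end Tally

/-! ### Unanimity and strategy-proofness of group min-max rules -/

section MinMax

variable {n m g : ℕ} [NeZero m] {grp : Fin n → Fin g} {f : DSCR n m} {β : Gam grp → Fin m}

theorem IsGroupMinMaxWith.eq_of_top_eq (h : IsGroupMinMaxWith grp f β) {P : Fin n → SPPref m}
    {p : Fin m} (hP : ∀ i, (P i).top = p) : f P = p := by
  refine le_antisymm ?_ (not_lt.1 fun hlt => ?_)
  · rw [h.le_iff, tally, countWith_eq_top grp fun i => (hP i).le, h.2.1]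
    exact bot_le
  · rw [h.lt_iff, tallyLt, countWith_eq_bot grp fun i => (hP i).not_lt, h.1] at hlt
    exact not_top_lt hlt

/-- A voter with top before the outcome is already counted there, so a misreport cannot raise the
tally and pull the outcome further down; the other side is symmetric. Thus the outcome stays between
the voter's top and any outcome of a deviation. -/
theorem IsGroupMinMaxWith.rel_update (h : IsGroupMinMaxWith grp f β) (i : Fin n)
    (P : Fin n → SPPref m) (r : SPPref m) : (P i).rel (f P) (f (Function.update P i r)) := by
  rcases eq_or_ne (P i).top (f P) with heq | hne
  · exact heq ▸ (P i).rel_top _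
  apply SPPref.rel_of_between
  rcases le_or_gt (P i).top (f P) with ht | ht
  · refine Or.inl ⟨ht, not_lt.1 fun hlt => ?_⟩
    refine lt_irrefl (f P) ((h.lt_iff P _).2 (lt_of_le_of_lt (h.2.2.1 _ _
      (countWith_mono grp fun j hj => ?_)) ((h.lt_iff _ _).1 hlt)))
    by_cases hji : j = i
    · rw [hji]
      exact lt_of_le_of_ne ht hne
    · simpa [hji] using hj
  · refine Or.inr ⟨?_, ht.le⟩
    rw [h.le_iff]
    refine le_trans (h.2.2.1 _ _ (countWith_mono grp fun j hj => ?_)) ((h.le_iff P _).1 le_rfl)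
    by_cases hji : j = i
    · rw [hji] at hj
      exact absurd hj (not_le.2 ht)
    · simpa [hji] using hj

end MinMax

/-! ### Mixtures of group min-max rules -/

theorem probSet_mono {m : ℕ} (d : stdSimplex ℝ (Fin m)) {A B : Finset (Fin m)} (h : A ⊆ B) :
    probSet d A ≤ probSet d B :=
  Finset.sum_le_sum_of_subset_of_nonneg h fun _ _ _ => prob_nonneg _ _

theorem probSet_nonneg {m : ℕ} (d : stdSimplex ℝ (Fin m)) (A : Finset (Fin m)) :
    0 ≤ probSet d A :=
  Finset.sum_nonneg fun _ _ => prob_nonneg _ _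

theorem probSet_univ {m : ℕ} (d : stdSimplex ℝ (Fin m)) : probSet d Finset.univ = 1 := sum_prob d

theorem probSet_le_one {m : ℕ} (d : stdSimplex ℝ (Fin m)) (A : Finset (Fin m)) :
    probSet d A ≤ 1 :=
  (probSet_mono d (Finset.subset_univ A)).trans_eq (probSet_univ d)

theorem eq_of_sum_Iic_eq {m : ℕ} {a b : Fin m → ℝ}
    (h : ∀ k, ∑ p ∈ Finset.Iic k, a p = ∑ p ∈ Finset.Iic k, b p) : a = b := by
  funext k
  induction hk : (k : ℕ) using Nat.strong_induction_on generalizing k with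
  | _ N ih =>
    have h1 := h k
    rw [← Finset.Iio_insert, Finset.sum_insert (by simp), Finset.sum_insert (by simp)] at h1
    have h2 : ∑ p ∈ Finset.Iio k, a p = ∑ p ∈ Finset.Iio k, b p :=
      Finset.sum_congr rfl fun p hp => ih p (by have := Finset.mem_Iio.1 hp; omega) p rfl
    linarith

section Mixture

variable {n m g : ℕ} [NeZero m] {grp : Fin n → Fin g} {φ : RSCR n m}

theorem RandomGroupMinMax.probSet_eq (D : RandomGroupMinMax grp φ) (P : Fin n → SPPref m)
    (A : Finset (Fin m)) :
    probSet (φ P) A = ∑ w ∈ Finset.univ.filter fun w => D.rule w P ∈ A, D.weight w := by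
  unfold probSet
  rw [Finset.sum_congr rfl fun p _ => D.eq_mixture P p, Finset.sum_comm, Finset.sum_filter]
  refine Finset.sum_congr rfl fun w _ => ?_
  simp

theorem RandomGroupMinMax.prob_eq (D : RandomGroupMinMax grp φ) (P : Fin n → SPPref m)
    (p : Fin m) :
    prob (φ P) p = ∑ w ∈ Finset.univ.filter fun w => D.rule w P = p, D.weight w := by
  simpa [probSet] using D.probSet_eq P {p}

/-- Components of weight zero may be arbitrary rules, so implications between events are only
available at positive weight. -/
theorem RandomGroupMinMax.sum_filter_le (D : RandomGroupMinMax grp φ) {p q : Fin D.size → Prop}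
    [DecidablePred p] [DecidablePred q] (h : ∀ w, 0 < D.weight w → p w → q w) :
    ∑ w ∈ Finset.univ.filter p, D.weight w ≤ ∑ w ∈ Finset.univ.filter q, D.weight w := by
  rw [Finset.sum_filter, Finset.sum_filter]
  refine Finset.sum_le_sum fun w _ => ?_
  rcases (D.weight_mem w).1.eq_or_lt with h0 | h0
  · simp [← h0]
  · by_cases hp : p w
    · simp [hp, h w h0 hp]
    · rw [if_neg hp]
      split_ifs
      · exact h0.le
      · exact le_rfl

theorem RandomGroupMinMax.sum_filter_congr (D : RandomGroupMinMax grp φ)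
    {p q : Fin D.size → Prop} [DecidablePred p] [DecidablePred q]
    (h : ∀ w, 0 < D.weight w → (p w ↔ q w)) :
    ∑ w ∈ Finset.univ.filter p, D.weight w = ∑ w ∈ Finset.univ.filter q, D.weight w :=
  le_antisymm (D.sum_filter_le fun w hw => (h w hw).1) (D.sum_filter_le fun w hw => (h w hw).2)

theorem RandomGroupMinMax.unanimous (D : RandomGroupMinMax grp φ) : Unanimous φ := by
  intro p P hP
  rw [D.prob_eq, D.sum_filter_congr (q := fun _ => True) fun w hw =>
    iff_true_intro ((D.isGroupMinMax w hw).eq_of_top_eq hP)]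
  simpa using D.weight_sum

theorem RandomGroupMinMax.strategyProof (D : RandomGroupMinMax grp φ) : StrategyProof φ := by
  intro i P r p
  rw [D.probSet_eq, D.probSet_eq]
  refine D.sum_filter_le fun w hw h => ?_
  simp only [SPPref.upper, Finset.mem_filter, Finset.mem_univ, true_and] at h ⊢
  exact (P i).trans _ _ _ ((D.isGroupMinMax w hw).rel_update i P r) h

theorem tally_perm {π : Equiv.Perm (Fin n)} (hπ : ∀ i, grp (π i) = grp i)
    (P : Fin n → SPPref m) (k : Fin m) :
    tally grp (fun i => P (π i)) k = tally grp P k := by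
  funext q
  apply Fin.ext
  change (Finset.univ.filter fun i : Members grp q => (P (π i.1)).top ≤ k).card =
    (Finset.univ.filter fun i : Members grp q => (P i.1).top ≤ k).card
  refine Finset.card_bij (fun i _ => ⟨π i.1, (hπ i.1).trans i.2⟩) (fun i hi => by simpa using hi)
    (fun i _ j _ h => Subtype.ext (π.injective (congrArg Subtype.val h))) fun j hj =>
    ⟨⟨π.symm j.1, ?_⟩, ?_, ?_⟩
  · rw [← hπ, π.apply_symm_apply]
    exact j.2
  · simpa using hj
  · simp

theorem RandomGroupMinMax.groupwiseAnonymous (D : RandomGroupMinMax grp φ) :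
    GroupwiseAnonymous grp φ := by
  intro π hπ P
  refine Subtype.ext (funext fun p => ?_)
  change prob (φ P) p = prob (φ _) p
  rw [D.prob_eq, D.prob_eq]
  refine D.sum_filter_congr fun w hw => ?_
  have : D.rule w P = D.rule w fun i => P (π i) := eq_of_forall_ge_iff fun k => by
    rw [(D.isGroupMinMax w hw).le_iff, (D.isGroupMinMax w hw).le_iff, tally_perm hπ]
  rw [this]

/-- The probability of an interval in terms of the parameters. -/
theorem RandomGroupMinMax.probSet_Icc_eq (D : RandomGroupMinMax grp φ) (P : Fin n → SPPref m)
    {x y : Fin m} {γ γ' : Gam grp} (hx : x = ⊥ ∨ tallyLt grp P x = γ')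
    (hy : y = ⊤ ∨ tally grp P y = γ) :
    probSet (φ P) (Finset.Icc x y) =
      ∑ w ∈ Finset.univ.filter fun w => x ≤ D.param w γ' ∧ D.param w γ ≤ y, D.weight w := by
  rw [D.probSet_eq]
  refine D.sum_filter_congr fun w hw => ?_
  rw [Finset.mem_Icc]
  refine and_congr ?_ ?_
  · rcases hx with rfl | rfl
    · simp
    · rw [← not_lt, ← not_lt, (D.isGroupMinMax w hw).lt_iff]
  · rcases hy with rfl | rfl
    · simp
    · rw [(D.isGroupMinMax w hw).le_iff]

end Mixture

/-! ### The entitlement guarantee as a condition on weights -/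

section Guarantee

variable {n m g : ℕ} [NeZero m] {grp : Fin n → Fin g} {φ : RSCR n m} {κ : Fin g → ℕ}
  {ψ : RepScenario m grp} {η : Fin g → ℝ}

/-- An interval of `κ q ≥ 1` projects starting at `x` ends at position `x + κ q - 1`; this
translates the arithmetic bound of the weight condition into the order of the projects. -/
theorem Compliant.eq_Icc (hψ : Compliant κ ψ) (hκ : ∀ q, 1 ≤ κ q) (q : Fin g)
    (Q : Members grp q → SPPref m) : ∃ x y : Fin m, ψ q Q = Finset.Icc x y ∧ x ≤ y ∧
      ∀ b : Fin m, (b : ℕ) ≤ (x : ℕ) + κ q - 1 ↔ b ≤ y := by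
  obtain ⟨⟨x, y, hxy⟩, hc⟩ := (hψ q).2 Q
  have := hκ q
  rw [hxy, Fin.card_Icc] at hc
  refine ⟨x, y, hxy, ?_, fun b => ?_⟩
  · rw [Fin.le_def]
    omega
  · rw [Fin.le_def]
    omega

/-- Outside group `q`, the first `γ'` members of each group get top `⊥`, those from there up to `γ`
get top `x`, and the rest get top `⊤`. No top precedes `⊥` or follows `⊤`, so at these ends the
counts cannot be prescribed; there the corresponding bound on the outcome is vacuous. -/
theorem exists_profile_of_le {q : Fin g} {γ γ' : Gam grp} (hγ : γ' ≤ γ) {x y : Fin m}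
    (hxy : x ≤ y) {Q : Members grp q → SPPref m}
    (hQx : (Finset.univ.filter fun i => (Q i).top < x).card = γ' q)
    (hQy : (Finset.univ.filter fun i => (Q i).top ≤ y).card = γ q) :
    ∃ P : Fin n → SPPref m, restrict grp P q = Q ∧ (x = ⊥ ∨ tallyLt grp P x = γ') ∧
      (y = ⊤ ∨ tally grp P y = γ) := by
  classical
  let P : Fin n → SPPref m := fun i => if h : grp i = q then Q ⟨i, h⟩ else
    if pos grp i < γ' (grp i) then prefOfTop ⊥ else
      if pos grp i < γ (grp i) then prefOfTop x else prefOfTop ⊤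
  have hPq : restrict grp P q = Q := by
    funext i
    simp [restrict, P, i.2]
  have hcount : ∀ (p : SPPref m → Prop) [DecidablePred p] (δ : Gam grp),
      (Finset.univ.filter fun i => p (Q i)).card = δ q →
      (∀ i, grp i ≠ q → (p (P i) ↔ pos grp i < δ (grp i))) →
      countWith grp (fun i => p (P i)) = δ := by
    intro p _ δ hδ hp
    funext h
    by_cases hh : h = q
    · subst hh
      apply Fin.ext
      rw [← hδ, ← hPq]
      rfl
    · rw [← congrFun (countWith_pos_lt grp δ) h]
      apply Fin.ext
      change (Finset.univ.filter fun i : Members grp h => p (P i.1)).card =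
        (Finset.univ.filter fun i : Members grp h => pos grp i.1 < δ (grp i.1)).card
      refine congrArg Finset.card (Finset.filter_congr fun i _ => hp i.1 ?_)
      rw [i.2]
      exact hh
  refine ⟨P, hPq, ?_, ?_⟩
  · by_cases hx : x = ⊥
    · exact Or.inl hx
    refine Or.inr (hcount (fun r => r.top < x) γ' hQx fun i hi => ?_)
    simp only [P, hi, dite_false]
    split_ifs with h1 h2
    · simp [h1, bot_lt_iff_ne_bot.2 hx]
    · simp [h1]
    · simp [h1]
  · by_cases hy : y = ⊤
    · exact Or.inl hy
    refine Or.inr (hcount (fun r => r.top ≤ y) γ hQy fun i hi => ?_)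
    simp only [P, hi, dite_false]
    split_ifs with h1 h2
    · simp [h1.trans_le (hγ (grp i))]
    · simp [h2, hxy]
    · simp [h2, hy]

/-- At a profile where `ψ q` selects `[x, y]`, the guarantee is the weight inequality for the
tallies before `x` and up to `y`. Conversely, the group profile that witnesses feasibility extends
to a full profile with the tallies `γ'` and `γ`. -/
theorem RandomGroupMinMax.weakGEG_iff (D : RandomGroupMinMax grp φ) (hψ : Compliant κ ψ)
    (hκ : ∀ q, 1 ≤ κ q) : WeakGEG ψ η φ ↔ D.WeightCondition κ ψ η := by
  constructor
  · rintro hG q γ γ' hγ x ⟨Q, y, hx, hy, hcx, hcy⟩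
    obtain ⟨x', y', hQ, hxy, hb⟩ := hψ.eq_Icc hκ q Q
    rw [hQ, Finset.coe_Icc] at hx hy
    obtain rfl := hx.unique (isLeast_Icc hxy)
    obtain rfl := hy.unique (isGreatest_Icc hxy)
    have hcy' : (Finset.univ.filter fun i => (Q i).top ≤ y).card = γ q := by
      have := Finset.card_filter_add_card_filter_not (s := Finset.univ) fun i => (Q i).top ≤ y
      simp only [not_le, Finset.card_univ] at this
      omega
    obtain ⟨P, hP, h1, h2⟩ := exists_profile_of_le hγ hxy hcx hcy'
    have := hG P q
    rw [hP, hQ, D.probSet_Icc_eq P h1 h2] at this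
    simpa only [hb] using this
  · intro hW P q
    obtain ⟨x, y, hQ, hxy, hb⟩ := hψ.eq_Icc hκ q (restrict grp P q)
    have hle : tallyLt grp P x ≤ tally grp P y :=
      countWith_mono grp fun i hi => hi.le.trans hxy
    have := hW q (tally grp P y) (tallyLt grp P x) hle x ⟨restrict grp P q, y, ?_, ?_, rfl, ?_⟩
    · rw [hQ, D.probSet_Icc_eq P (Or.inr rfl) (Or.inr rfl)]
      simpa only [hb] using this
    · rw [hQ, Finset.coe_Icc]
      exact isLeast_Icc hxy
    · rw [hQ, Finset.coe_Icc]
      exact isGreatest_Icc hxy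
    · have := Finset.card_filter_add_card_filter_not (s := Finset.univ)
        fun i => (restrict grp P q i).top ≤ y
      simp only [not_le, Finset.card_univ] at this
      rw [add_comm]
      exact this

end Guarantee

/-! ### Decomposition into deterministic rules -/

/-- Finitely many numbers in the unit interval are the values of the distribution function of a
finitely supported distribution on `(0, 1]`. -/
theorem exists_thresholds {ι : Type*} [Fintype ι] (x : ι → ℝ) (hx : ∀ a, 0 ≤ x a ∧ x a ≤ 1) :
    ∃ (N : ℕ) (u c : Fin N → ℝ), (∀ w, 0 < u w ∧ u w ≤ 1) ∧ (∀ w, 0 ≤ c w ∧ c w ≤ 1) ∧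
      ∑ w, c w = 1 ∧ ∀ a, ∑ w ∈ Finset.univ.filter (fun w => u w ≤ x a), c w = x a := by
  classical
  -- Thresholds are the positive values in sorted order, weights the gaps below them, so sums
  -- telescope. Including `0` starts the telescope at zero, and including `1` makes the total weight
  -- one.
  set V : Finset ℝ := insert 0 (insert 1 (Finset.univ.image x)) with hV
  have hV01 : ∀ v ∈ V, 0 ≤ v ∧ v ≤ 1 := by
    intro v hv
    simp only [hV, Finset.mem_insert, Finset.mem_image, Finset.mem_univ, true_and] at hv
    rcases hv with rfl | rfl | ⟨a, rfl⟩
    · simp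
    · simp
    · exact hx a
  have h0 : (0 : ℝ) ∈ V := by simp [hV]
  obtain ⟨N, hN⟩ : ∃ N, V.card = N + 1 :=
    ⟨V.card - 1, by have := Finset.card_pos.2 ⟨0, h0⟩; omega⟩
  let e : Fin (N + 1) ↪o ℝ := V.orderEmbOfFin hN
  have he : ∀ i, e i ∈ V := V.orderEmbOfFin_mem hN
  have hsurj : ∀ v ∈ V, ∃ i, e i = v := fun v hv => by
    have : v ∈ Set.range e := by rw [V.range_orderEmbOfFin hN]; exact hv
    exact this
  have he0 : e 0 = 0 := by
    obtain ⟨i, hi⟩ := hsurj 0 h0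
    exact le_antisymm (hi ▸ e.monotone (Fin.zero_le i)) (hV01 _ (he 0)).1
  have hsum : ∀ i : Fin (N + 1), ∑ w ∈ Finset.univ.filter (fun w : Fin N => e w.succ ≤ e i),
      (e w.succ - e w.castSucc) = e i := by
    intro i
    simp only [e.le_iff_le]
    induction i using Fin.induction with
    | zero => simp [he0, Fin.succ_ne_zero]
    | succ i ih =>
      have : (Finset.univ.filter fun w : Fin N => w.succ ≤ i.succ) =
          insert i (Finset.univ.filter fun w : Fin N => w.succ ≤ i.castSucc) := by
        ext w
        simp only [Finset.mem_filter, Finset.mem_univ, true_and, Finset.mem_insert, Fin.le_def,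
          Fin.ext_iff, Fin.val_succ, Fin.val_castSucc]
        omega
      rw [this, Finset.sum_insert (by simp [Fin.le_def]), ih]
      ring
  have hx' : ∀ v ∈ V, ∑ w ∈ Finset.univ.filter (fun w : Fin N => e w.succ ≤ v),
      (e w.succ - e w.castSucc) = v := fun v hv => by
    obtain ⟨i, rfl⟩ := hsurj v hv
    exact hsum i
  refine ⟨N, fun w => e w.succ, fun w => e w.succ - e w.castSucc, fun w => ⟨?_, ?_⟩,
    fun w => ⟨?_, ?_⟩, ?_, fun a => hx' _ ?_⟩
  · rw [← he0]
    exact e.strictMono (Fin.succ_pos w)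
  · exact (hV01 _ (he _)).2
  · exact sub_nonneg.2 (e.monotone (Fin.castSucc_lt_succ).le)
  · linarith [(hV01 _ (he w.succ)).2, (hV01 _ (he w.castSucc)).1]
  · rw [← hx' 1 (by simp [hV]), Finset.filter_true_of_mem fun w _ => (hV01 _ (he _)).2]
  · simp [hV]

section Decomposition

variable {n m g : ℕ} [NeZero m] {grp : Fin n → Fin g} {φ : RSCR n m}

/-- A profile in which `γ q` members of the group `q` have the first project at the top, and all
other voters have the last project at the top. -/
noncomputable def extremeProfile (m : ℕ) [NeZero m] (grp : Fin n → Fin g) (γ : Gam grp) :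
    Fin n → SPPref m :=
  fun i => if pos grp i < γ (grp i) then prefOfTop ⊥ else prefOfTop ⊤

theorem tally_extremeProfile (γ : Gam grp) {k : Fin m} (hk : k ≠ ⊤) :
    tally grp (extremeProfile m grp γ) k = γ := by
  refine (countWith_congr grp fun i => ?_).trans (countWith_pos_lt grp γ)
  unfold extremeProfile
  split_ifs with h
  · simp [h]
  · simp [h, hk]

theorem probSet_Iic_eq_of_tally_eq (hun : Unanimous φ) (hsp : StrategyProof φ)
    (han : GroupwiseAnonymous grp φ) {P Q : Fin n → SPPref m} {k : Fin m}
    (h : tally grp P k = tally grp Q k) :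
    probSet (φ P) (Finset.Iic k) = probSet (φ Q) (Finset.Iic k) := by
  obtain ⟨π, hπ, hPQ⟩ := exists_perm_of_countWith_eq grp h
  rw [han π hπ P]
  exact hsp.probSet_Iic_eq hun hPQ

/-- Extreme profiles thus determine `φ` completely. At `k = ⊤` the tallies need not agree, but both
probabilities are one. -/
theorem probSet_Iic_extremeProfile_tally (hun : Unanimous φ) (hsp : StrategyProof φ)
    (han : GroupwiseAnonymous grp φ) (P : Fin n → SPPref m) (k : Fin m) :
    probSet (φ (extremeProfile m grp (tally grp P k))) (Finset.Iic k) =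
      probSet (φ P) (Finset.Iic k) := by
  rcases eq_or_ne k ⊤ with rfl | hk
  · rw [Finset.Iic_top, probSet_univ, probSet_univ]
  · exact probSet_Iic_eq_of_tally_eq hun hsp han (tally_extremeProfile _ hk)

/-- Quantile coupling: a common random level `u` selects the `u`-quantile of `φ P` at every profile
at once. Each level gives a deterministic rule whose parameters are the quantiles at the extreme
profiles. -/
theorem nonempty_randomGroupMinMax (hun : Unanimous φ) (hsp : StrategyProof φ)
    (han : GroupwiseAnonymous grp φ) : Nonempty (RandomGroupMinMax grp φ) := by
  classical
  set F : Gam grp → Fin m → ℝ := fun γ k =>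
    probSet (φ (extremeProfile m grp γ)) (Finset.Iic k) with hF
  have hFk : ∀ γ k l, k ≤ l → F γ k ≤ F γ l := fun γ k l h =>
    probSet_mono _ (Finset.Iic_subset_Iic.2 h)
  have hFγ : ∀ γ γ' k, γ' ≤ γ → F γ' k ≤ F γ k := by
    refine fun γ γ' k h => hsp.probSet_Iic_le (fun i => ?_) k
    unfold extremeProfile
    split_ifs with h1 h2
    · exact Or.inl rfl
    · exact absurd (h1.trans_le (h (grp i))) h2
    · exact Or.inr (top_prefOfTop ⊥)
    · exact Or.inl rfl
  have hF1 : ∀ γ, F γ ⊤ = 1 := fun γ => by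
    simp only [hF, Finset.Iic_top, probSet_univ]
  have hP : ∀ P k, F (tally grp P k) k = probSet (φ P) (Finset.Iic k) :=
    probSet_Iic_extremeProfile_tally hun hsp han
  have hFtop : F ⊤ ⊥ = 1 := by
    have h := hP (fun _ => prefOfTop ⊥) ⊥
    rw [tally, countWith_eq_top grp fun i => by simp] at h
    have hbot : Finset.Iic (⊥ : Fin m) = {⊥} := by
      ext k
      simp
    rw [h, hbot]
    simpa [probSet] using hun ⊥ (fun _ => prefOfTop ⊥) fun _ => by simp
  have hFbot : ∀ k, k ≠ ⊤ → F ⊥ k = 0 := by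
    intro k hk
    have h := hP (fun _ => prefOfTop ⊤) k
    rw [tally, countWith_eq_bot grp fun i => by simpa using hk] at h
    rw [h]
    refine Finset.sum_eq_zero fun x hx => ?_
    refine prob_eq_zero_of_ne (hun ⊤ (fun _ => prefOfTop ⊤) fun _ => by simp) ?_
    rintro rfl
    exact hk (top_unique (Finset.mem_Iic.1 hx))
  -- One list of levels serves all pairs `(γ, k)`, so the weights do not depend on the profile.
  obtain ⟨N, u, c, hu, hc, hc1, hsum⟩ := exists_thresholds (fun a : Gam grp × Fin m => F a.1 a.2)
    fun a => ⟨probSet_nonneg _ _, probSet_le_one _ _⟩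
  let β : Fin N → Gam grp → Fin m := fun w γ => (Finset.univ.filter fun k => u w ≤ F γ k).inf id
  let f : Fin N → DSCR n m := fun w P =>
    (Finset.univ.filter fun k => u w ≤ probSet (φ P) (Finset.Iic k)).inf id
  have hβ : ∀ w γ k, β w γ ≤ k ↔ u w ≤ F γ k := fun w γ k =>
    inf_filter_le_iff (p := fun k => u w ≤ F γ k) (fun a b hab h => h.trans (hFk γ a b hab))
      ((hu w).2.trans_eq (hF1 γ).symm) k
  have hf : ∀ w P k, f w P ≤ k ↔ u w ≤ probSet (φ P) (Finset.Iic k) := fun w P k =>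
    inf_filter_le_iff (p := fun k => u w ≤ probSet (φ P) (Finset.Iic k))
      (fun a b hab h => h.trans (probSet_mono _ (Finset.Iic_subset_Iic.2 hab)))
      (by rw [Finset.Iic_top, probSet_univ]; exact (hu w).2) k
  refine ⟨⟨N, c, f, β, hc, hc1, fun w _ => isGroupMinMaxWith_of_le_iff ?_ ?_ ?_ ?_, ?_⟩⟩
  · by_contra hne
    have := (hβ w ⊥ _).1 le_rfl
    rw [hFbot _ hne] at this
    exact absurd this (not_le.2 (hu w).1)
  · exact bot_unique ((hβ w ⊤ ⊥).2 (hFtop ▸ (hu w).2))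
  · exact fun γ γ' h => (hβ w γ _).2 (((hβ w γ' _).1 le_rfl).trans (hFγ γ γ' _ h))
  · intro P k
    rw [hf, hβ, hP]
  · intro P
    refine congrFun (eq_of_sum_Iic_eq fun k => ?_)
    change probSet (φ P) (Finset.Iic k) = _
    rw [Finset.sum_comm, ← hP, ← hsum (tally grp P k, k), Finset.sum_filter]
    refine Finset.sum_congr rfl fun w _ => ?_
    have : u w ≤ F (tally grp P k) k ↔ f w P ≤ k := by rw [hf, hP]
    simp [this]

end Decomposition

end GroupFair

open GroupFair
theorem mainTheorem6 {n m g : ℕ} [NeZero m] (hn : 2 ≤ n) (grp : Fin n → Fin g)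
    (κ : Fin g → ℕ) (hκ : ∀ q, 1 ≤ κ q ∧ κ q ≤ m)
    (η : Fin g → ℝ) (hη : ∀ q, 0 ≤ η q ∧ η q ≤ 1)
    (ψ : RepScenario m grp) (hψ : Compliant κ ψ) (φ : RSCR n m) :
    ((Unanimous φ ∧ StrategyProof φ ∧ GroupwiseAnonymous grp φ ∧ WeakGEG ψ η φ) ↔
      ∃ D : RandomGroupMinMax grp φ, D.WeightCondition κ ψ η) ∧
    ((Unanimous φ ∧ StrategyProof φ ∧ GroupwiseAnonymous grp φ ∧ WeakGEG ψ η φ) →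
      ∀ D : RandomGroupMinMax grp φ, D.WeightCondition κ ψ η) := by
  -- The left side does not mention `D`; this is why the condition holds for one representation iff
  -- it holds for all.
  have hiff : ∀ D : RandomGroupMinMax grp φ, WeakGEG ψ η φ ↔ D.WeightCondition κ ψ η :=
    fun D => D.weakGEG_iff hψ fun q => (hκ q).1
  refine ⟨⟨?_, ?_⟩, fun h D => (hiff D).1 h.2.2.2⟩
  · rintro ⟨hun, hsp, han, hG⟩
    obtain ⟨D⟩ := nonempty_randomGroupMinMax hun hsp han
    exact ⟨D, (hiff D).1 hG⟩
  · rintro ⟨D, hD⟩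
    exact ⟨D.unanimous, D.strategyProof, D.groupwiseAnonymous, (hiff D).2 hD⟩
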